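/- Let $\mathfrak{S}_n$ denote the set of permutations of $[n]=\{1,\dots,n\}$, and let $\sigma\in\mathfrak{S}_n$. Let $\ell_S(\sigma)$ be the least $k$ such that $\sigma$ is a product of $k$ adjacent transpositions, let $\ell_T(\sigma)$ be the least $k$ such that $\sigma$ is a product of $k$ conjugates of adjacent transpositions, and let $\mathrm{depth}(\sigma)=\sum_{i:\,\sigma(i)>i}(\sigma(i)-i)$. Call $\sigma$ \emph{shallow} if $\mathrm{depth}(\sigma)=\frac{\ell_S(\sigma)+\ell_T(\sigma)}{2}$. Let $\Phi(\sigma)\in\mathfrak{S}_n$ be the image of $\sigma$ under the fundamental bijection: write $\sigma$ as a product of disjoint cycles $(x\ \sigma(x)\ \sigma^2(x)\cdots)$, including cycles of size one, each written with its largest element first, and with the cycles ordered from left to right by increasing largest element; then erase the parentheses to obtain the one-line notation of $\Phi(\sigma)$. A \emph{vincular pattern} is a permutation $\pi\in\mathfrak{S}_k$ some of whose adjacent letters in one-line notation are bonded, indicated by underbrackets. A permutation $\tau\in\mathfrak{S}_n$ \emph{contains} it if there are positions $p_1<\dots<p_k$ in $[n]$ such that $\tau(p_i)\le\tau(p_j)$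 if and only if $\pi(i)\le\pi(j)$, for all $i,j$, and $p_{i+1}=p_i+1$ whenever the letters $\pi(i)$ and $\pi(i+1)$ are bonded; otherwise $\tau$ \emph{avoids} it. \textbf{Theorem.} For every $n$, a permutation $\sigma\in\mathfrak{S}_n$ is shallow if and only if $\Phi(\sigma)$ avoids all three of the vincular patterns $\underbracket{5}\,\underbracket{24}\,\underbracket{13}$, $\underbracket{4}\,\underbracket{25}\,\underbracket{13}$ and $\underbracket{31}\,\underbracket{42}$ (that is, $52413$ with $24$ and $13$ bonded, $42513$ with $25$ and $13$ bonded, and $3142$ with $31$ and $42$ bonded). -/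

import Mathlib

/-!
Permutations of an `n`-element chain are elements of `Equiv.Perm (Fin n)`; the letters
`1, …, n` are represented by `0, …, n - 1`, and the one-line notation of `σ` is the word
`σ 0, σ 1, …, σ (n - 1)`.
-/

namespace ShallowPerm

open Equiv

/-! ### Length, reflection length, depth -/

/-- The least number of factors, all taken from `A`, in a product equal to `g`. -/
noncomputable def wordLength {G : Type*} [Group G] (A : Set G) (g : G) : ℕ :=
  sInf {k : ℕ | ∃ l : List G, (∀ a ∈ l, a ∈ A) ∧ l.prod = g ∧ l.length = k}

/-- The simple reflections: the transpositions of adjacent letters `i`, `i + 1`. -/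
def simpleReflections (n : ℕ) : Set (Perm (Fin n)) :=
  {s | ∃ i j : Fin n, (j : ℕ) = (i : ℕ) + 1 ∧ s = swap i j}

/-- The reflections: the conjugates of the simple reflections. -/
def reflections (n : ℕ) : Set (Perm (Fin n)) :=
  {t | ∃ s ∈ simpleReflections n, ∃ g : Perm (Fin n), t = g * s * g⁻¹}

/-- The length of `σ`. -/
noncomputable def lengthS {n : ℕ} (σ : Perm (Fin n)) : ℕ :=
  wordLength (simpleReflections n) σ

/-- The reflection length of `σ`. -/
noncomputable def lengthT {n : ℕ} (σ : Perm (Fin n)) : ℕ :=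
  wordLength (reflections n) σ

/-- The depth of `σ`: the sum of `σ i - i` over all `i` with `σ i > i`. -/
def depth {n : ℕ} (σ : Perm (Fin n)) : ℤ :=
  ∑ i : Fin n with i < σ i, (((σ i : ℕ) : ℤ) - ((i : ℕ) : ℤ))

/-- `σ` is shallow if its depth is the average of its length and its reflection length. -/
def IsShallow {n : ℕ} (σ : Perm (Fin n)) : Prop :=
  (depth σ : ℚ) = ((lengthS σ : ℚ) + (lengthT σ : ℚ)) / 2

/-! ### The fundamental bijection -/

/-- The set of letters in the cycle of `σ` through `x` (fixed points are cycles of size one). -/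
def cycleSet {n : ℕ} (σ : Perm (Fin n)) (x : Fin n) : Finset (Fin n) :=
  {y | σ.SameCycle x y}

/-- The cycle of `σ` through `x`, written as the word `x, σ x, σ (σ x), …` starting at `x`. -/
def cycleWord {n : ℕ} (σ : Perm (Fin n)) (x : Fin n) : List (Fin n) :=
  (List.range (cycleSet σ x).card).map fun k => (σ ^ k) x

/-- The largest elements of the cycles of `σ`, in increasing order. -/
def cycleMaxima {n : ℕ} (σ : Perm (Fin n)) : List (Fin n) :=
  (List.finRange n).filter fun m => ∀ y ∈ cycleSet σ m, y ≤ m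

/-- The standard representation of `σ` with the cycle demarcations erased: each cycle is written
with its largest element first, and the cycles are written from left to right in increasing order
of their largest elements. -/
def standardWord {n : ℕ} (σ : Perm (Fin n)) : List (Fin n) :=
  (cycleMaxima σ).flatMap (cycleWord σ)

theorem isCycleOn_cycleSet {n : ℕ} (σ : Perm (Fin n)) (x : Fin n) :
    σ.IsCycleOn (cycleSet σ x : Set (Fin n)) := by
  have h : (cycleSet σ x : Set (Fin n)) = {y | σ.SameCycle x y} := by
    ext y; simp [cycleSet]
  rw [h]
  refine ⟨σ.bijOn fun y => Perm.sameCycle_apply_right, ?_⟩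
  intro a ha b hb
  exact (Perm.SameCycle.symm ha).trans hb

theorem self_mem_cycleSet {n : ℕ} (σ : Perm (Fin n)) (x : Fin n) : x ∈ cycleSet σ x := by
  simp [cycleSet, Perm.SameCycle.refl]

theorem mem_cycleWord {n : ℕ} (σ : Perm (Fin n)) (x y : Fin n) :
    y ∈ cycleWord σ x ↔ σ.SameCycle x y := by
  constructor
  · intro h
    obtain ⟨k, -, rfl⟩ := List.mem_map.1 h
    exact ⟨k, by simp⟩
  · intro h
    obtain ⟨k, hk, e⟩ := (isCycleOn_cycleSet σ x).exists_pow_eq (self_mem_cycleSet σ x)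
      (show y ∈ cycleSet σ x by simpa [cycleSet] using h)
    exact List.mem_map.2 ⟨k, List.mem_range.2 hk, e⟩

theorem mem_cycleMaxima {n : ℕ} (σ : Perm (Fin n)) (m : Fin n) :
    m ∈ cycleMaxima σ ↔ ∀ y, σ.SameCycle m y → y ≤ m := by
  simp [cycleMaxima, cycleSet]

theorem mem_standardWord {n : ℕ} (σ : Perm (Fin n)) (x : Fin n) : x ∈ standardWord σ := by
  obtain ⟨m, hm, hmax⟩ := (cycleSet σ x).exists_max_image id ⟨x, self_mem_cycleSet σ x⟩
  have hxm : σ.SameCycle x m := by simpa [cycleSet] using hm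
  refine List.mem_flatMap.2 ⟨m, (mem_cycleMaxima σ m).2 fun y hy => ?_,
    (mem_cycleWord σ m x).2 hxm.symm⟩
  exact hmax y (by simpa [cycleSet] using hxm.trans hy)

theorem nodup_standardWord {n : ℕ} (σ : Perm (Fin n)) : (standardWord σ).Nodup := by
  refine List.nodup_flatMap.2 ⟨fun m _ => ?_, ?_⟩
  · refine List.Nodup.map_on ?_ List.nodup_range
    intro a ha b hb e
    have h := ((isCycleOn_cycleSet σ m).pow_apply_eq_pow_apply (self_mem_cycleSet σ m)).1 e
    exact Nat.ModEq.eq_of_lt_of_lt h (List.mem_range.1 ha) (List.mem_range.1 hb)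
  · refine List.Nodup.pairwise_of_forall_ne ((List.nodup_finRange n).filter _) ?_
    intro a ha b hb hab x hxa hxb
    have h : σ.SameCycle a b :=
      ((mem_cycleWord σ a x).1 hxa).trans ((mem_cycleWord σ b x).1 hxb).symm
    exact hab (le_antisymm ((mem_cycleMaxima σ b).1 hb a h.symm)
      ((mem_cycleMaxima σ a).1 ha b h))

theorem length_standardWord {n : ℕ} (σ : Perm (Fin n)) : (standardWord σ).length = n := by
  rw [← List.toFinset_card_of_nodup (nodup_standardWord σ),
    Finset.eq_univ_of_forall fun x => List.mem_toFinset.2 (mem_standardWord σ x)]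
  simp

/-- The image `Φ(σ)` of `σ` under the fundamental bijection: the permutation whose one-line
notation is the standard representation of `σ` with the cycle demarcations erased. -/
def fundamental {n : ℕ} (σ : Perm (Fin n)) : Perm (Fin n) :=
  (finCongr (length_standardWord σ).symm).trans
    ((nodup_standardWord σ).getEquivOfForallMemList _ (mem_standardWord σ))

/-! ### Vincular patterns -/

/-- A vincular pattern of size `k`: a permutation together with the set of those positions `i` of
its one-line notation whose letter is bonded to the letter at position `i + 1`. -/
structure VincularPattern (k : ℕ) where
  perm : Perm (Fin k)
  bonds : Finset (Fin k)

/-- The letters of `τ` at the positions `p 0 < p 1 < ⋯ < p (k - 1)` are an occurrence of `π`: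
they are order isomorphic to `π`, and bonded letters are consecutive in `τ`. -/
def VincularPattern.IsOccurrence {k n : ℕ} (π : VincularPattern k) (τ : Perm (Fin n))
    (p : Fin k ↪o Fin n) : Prop :=
  (∀ i j : Fin k, τ (p i) ≤ τ (p j) ↔ π.perm i ≤ π.perm j) ∧
    ∀ i j : Fin k, i ∈ π.bonds → (j : ℕ) = (i : ℕ) + 1 → ((p j : Fin n) : ℕ) = (p i : ℕ) + 1

/-- `τ` avoids the vincular pattern `π`. -/
def Avoids {k n : ℕ} (τ : Perm (Fin n)) (π : VincularPattern k) : Prop :=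
  ¬ ∃ p : Fin k ↪o Fin n, π.IsOccurrence τ p

/-- The permutation with one-line notation `w`. -/
noncomputable def ofOneLine {k : ℕ} (w : Fin k → Fin k) (hw : Function.Injective w) :
    Perm (Fin k) :=
  Equiv.ofBijective w (Finite.injective_iff_bijective.1 hw)

/-- The permutation `52413` with the bonds `24` and `13` (letters shifted down by one). -/
noncomputable def pattern_5_24_13 : VincularPattern 5 where
  perm := ofOneLine ![4, 1, 3, 0, 2] (by decide)
  bonds := {1, 3}

/-- The permutation `42513` with the bonds `25` and `13` (letters shifted down by one). -/
noncomputable def pattern_4_25_13 : VincularPattern 5 where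
  perm := ofOneLine ![3, 1, 4, 0, 2] (by decide)
  bonds := {1, 3}

/-- The permutation `3142` with the bonds `31` and `42` (letters shifted down by one). -/
noncomputable def pattern_31_42 : VincularPattern 4 where
  perm := ofOneLine ![2, 0, 3, 1] (by decide)
  bonds := {0, 2}

end ShallowPerm

/-! Let `m` be the smallest letter moved by `σ`, with `j → m → k`. Detaching it (`j → k`, with `m`
fixed) changes the excess, twice the depth minus length minus reflection length, by an explicit
amount. With `E` the set of positions strictly between `m` and `j` whose value is below `k`, the
depth drops by `min k j - m`, the inversion number by `1 + 2 * |E|` and the reflection length by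
`1`, so the excess drops by `2 * (min k j - m - 1 - |E|)`. Since `E` lies in the open interval from
`m` to `j` and `σ(E)` in the one from `m` to `k`, this drop is nonnegative, and it vanishes exactly
when no arc jumps over the interval between `j` and `k` (`excess_detach_cases`). Hence `σ` is
shallow iff no such jump ever occurs while letters are detached down to the identity.

The standard word obeys the same recursion. Detaching `m` keeps the relative order of the other
letters, and `σ` has a crossing out of order (`AscentCrossing` or `DescentCrossing`) iff the
detached permutation has one or a jump occurs (`crossing_iff_detach`). By induction, excess zero
means no such crossing (`excess_main`). Finally, an ascent crossing is an occurrence of one of the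
two patterns of size 5, according to whether the upper ascent ends at its cycle maximum, and a
descent crossing is an occurrence of `31 42`. -/

namespace ShallowPerm

open Equiv

/-! ### Cycle maxima and positions in the standard representation -/

/-- The largest element of the cycle of `σ` through `x`. -/
noncomputable def cycleMax {n : ℕ} (σ : Perm (Fin n)) (x : Fin n) : Fin n :=
  (cycleSet σ x).max' ⟨x, self_mem_cycleSet σ x⟩

theorem mem_cycleSet {n : ℕ} (σ : Perm (Fin n)) (x y : Fin n) :
    y ∈ cycleSet σ x ↔ σ.SameCycle x y := by
  simp [cycleSet]

theorem sameCycle_cycleMax {n : ℕ} (σ : Perm (Fin n)) (x : Fin n) :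
    σ.SameCycle x (cycleMax σ x) :=
  (mem_cycleSet σ x _).1 (Finset.max'_mem _ _)

theorem le_cycleMax_of_sameCycle {n : ℕ} {σ : Perm (Fin n)} {x y : Fin n}
    (h : σ.SameCycle x y) : y ≤ cycleMax σ x :=
  Finset.le_max' _ _ ((mem_cycleSet σ x y).2 h)

theorem le_cycleMax {n : ℕ} (σ : Perm (Fin n)) (x : Fin n) : x ≤ cycleMax σ x :=
  le_cycleMax_of_sameCycle (Perm.SameCycle.refl σ x)

theorem cycleMax_eq_iff {n : ℕ} (σ : Perm (Fin n)) (x y : Fin n) :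
    cycleMax σ x = cycleMax σ y ↔ σ.SameCycle x y := by
  refine ⟨fun h => (sameCycle_cycleMax σ x).trans (h ▸ (sameCycle_cycleMax σ y).symm),
    fun h => le_antisymm ?_ ?_⟩
  · exact le_cycleMax_of_sameCycle (h.symm.trans (sameCycle_cycleMax σ x))
  · exact le_cycleMax_of_sameCycle (h.trans (sameCycle_cycleMax σ y))

theorem cycleMax_apply {n : ℕ} (σ : Perm (Fin n)) (x : Fin n) :
    cycleMax σ (σ x) = cycleMax σ x :=
  (cycleMax_eq_iff σ _ _).2 (Perm.sameCycle_apply_left.2 (Perm.SameCycle.refl σ x))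

theorem cycleMax_cycleMax {n : ℕ} (σ : Perm (Fin n)) (x : Fin n) :
    cycleMax σ (cycleMax σ x) = cycleMax σ x :=
  (cycleMax_eq_iff σ _ _).2 (sameCycle_cycleMax σ x).symm

theorem apply_le_cycleMax {n : ℕ} (σ : Perm (Fin n)) (x : Fin n) : σ x ≤ cycleMax σ x :=
  cycleMax_apply σ x ▸ le_cycleMax σ (σ x)

theorem mem_cycleMaxima_iff {n : ℕ} (σ : Perm (Fin n)) (m : Fin n) :
    m ∈ cycleMaxima σ ↔ cycleMax σ m = m := by
  rw [mem_cycleMaxima]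
  exact ⟨fun h => le_antisymm (h _ (sameCycle_cycleMax σ m)) (le_cycleMax σ m),
    fun h y hy => h ▸ le_cycleMax_of_sameCycle hy⟩

/-- The position of the letter `x` in the standard representation of `σ`. -/
def pos {n : ℕ} (σ : Perm (Fin n)) (x : Fin n) : ℕ := (fundamental σ).symm x

theorem pos_injective {n : ℕ} (σ : Perm (Fin n)) : Function.Injective (pos σ) :=
  Fin.val_injective.comp (fundamental σ).symm.injective

theorem pos_fundamental {n : ℕ} (σ : Perm (Fin n)) (p : Fin n) :
    pos σ (fundamental σ p) = p := by
  simp [pos]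

theorem standardWord_getElem_pos {n : ℕ} (σ : Perm (Fin n)) (x : Fin n) :
    (standardWord σ)[pos σ x]'(by rw [length_standardWord]; exact Fin.is_lt _) = x :=
  (fundamental σ).apply_symm_apply x

theorem pos_eq_of_getElem? {n : ℕ} {σ : Perm (Fin n)} {x : Fin n} {q : ℕ}
    (h : (standardWord σ)[q]? = some x) : pos σ x = q := by
  obtain ⟨hq, e⟩ := List.getElem?_eq_some_iff.1 h
  have e' := (standardWord_getElem_pos σ x).trans e.symm
  exact (nodup_standardWord σ).getElem_inj_iff.1 e'

theorem pos_apply {n : ℕ} {σ : Perm (Fin n)} {x : Fin n} (h : cycleMax σ (σ x) ≠ σ x) :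
    pos σ (σ x) = pos σ x + 1 := by
  set M := cycleMax σ x with hM
  have hx : x ∈ cycleWord σ M := (mem_cycleWord σ M x).2 (sameCycle_cycleMax σ x).symm
  obtain ⟨a, ha, e⟩ := List.mem_map.1 hx
  have ha := List.mem_range.1 ha
  have e1 : (σ ^ (a + 1)) M = σ x := by
    rw [pow_succ', Perm.mul_apply, e]
  have ha1 : a + 1 < (cycleSet σ M).card := by
    refine lt_of_le_of_ne ha fun hc => h ?_
    rw [← e1, hc, (isCycleOn_cycleSet σ M).pow_card_apply (self_mem_cycleSet σ M), hM,
      cycleMax_cycleMax]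
  obtain ⟨l₁, l₂, hl⟩ := List.append_of_mem
    ((mem_cycleMaxima_iff σ M).2 (cycleMax_cycleMax σ x))
  have key : ∀ b, b < (cycleSet σ M).card →
      (standardWord σ)[(l₁.flatMap (cycleWord σ)).length + b]? = some ((σ ^ b) M) := by
    intro b hb
    have hlen : b < (cycleWord σ M).length := by simpa [cycleWord] using hb
    rw [standardWord, hl, List.flatMap_append, List.getElem?_append_right (by omega),
      Nat.add_sub_cancel_left, List.flatMap_cons, List.getElem?_append_left hlen]
    simp [cycleWord, hb]
  have h0 := pos_eq_of_getElem? (key a ha)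
  have h1 := pos_eq_of_getElem? (key (a + 1) ha1)
  rw [e] at h0
  rw [e1] at h1
  omega

theorem cycleMax_le_of_pos_lt {n : ℕ} {σ : Perm (Fin n)} {x y : Fin n}
    (h : pos σ x < pos σ y) : cycleMax σ x ≤ cycleMax σ y := by
  have hp : (standardWord σ).Pairwise fun a b => cycleMax σ a ≤ cycleMax σ b := by
    have hc : ∀ m ∈ cycleMaxima σ, ∀ a ∈ cycleWord σ m, cycleMax σ a = m := fun m hm a ha =>
      ((cycleMax_eq_iff σ _ _).2 ((mem_cycleWord σ m a).1 ha).symm).trans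
        ((mem_cycleMaxima_iff σ m).1 hm)
    rw [standardWord, List.pairwise_flatMap]
    refine ⟨fun m hm => List.pairwise_of_forall_mem_list fun a ha b hb =>
      (hc m hm a ha).trans_le (hc m hm b hb).ge, ?_⟩
    have hs : (cycleMaxima σ).Pairwise (· < ·) :=
      (List.pairwise_lt_finRange n).filter _
    refine hs.imp_of_mem fun hm hm' hlt a ha b hb => ?_
    rw [hc _ hm a ha, hc _ hm' b hb]
    exact hlt.le
  have := List.pairwise_iff_getElem.1 hp (pos σ x) (pos σ y)
    (by rw [length_standardWord]; exact Fin.is_lt _)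
    (by rw [length_standardWord]; exact Fin.is_lt _) h
  rwa [standardWord_getElem_pos, standardWord_getElem_pos] at this

theorem pos_lt_of_cycleMax_lt {n : ℕ} {σ : Perm (Fin n)} {x y : Fin n}
    (h : cycleMax σ x < cycleMax σ y) : pos σ x < pos σ y := by
  rcases lt_trichotomy (pos σ x) (pos σ y) with h' | h' | h'
  · exact h'
  · exact absurd (congrArg (cycleMax σ) (pos_injective σ h')) h.ne
  · exact absurd (cycleMax_le_of_pos_lt h') h.not_ge

/-- `y` directly follows `x` in the word of a cycle of `σ` written with its maximum first. -/
def Follows {n : ℕ} (σ : Perm (Fin n)) (x y : Fin n) : Prop :=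
  σ x = y ∧ cycleMax σ y ≠ y

theorem Follows.pos_eq {n : ℕ} {σ : Perm (Fin n)} {x y : Fin n} (h : Follows σ x y) :
    pos σ y = pos σ x + 1 := by
  obtain ⟨rfl, h⟩ := h
  exact pos_apply h

theorem pos_lt_of_transGen {n : ℕ} {σ : Perm (Fin n)} {x y : Fin n}
    (h : Relation.TransGen (Follows σ) x y) : pos σ x < pos σ y := by
  induction h with
  | single h => have := h.pos_eq; omega
  | tail _ h ih => have := h.pos_eq; omega

theorem reflTransGen_cycleMax {n : ℕ} (σ : Perm (Fin n)) (x : Fin n) :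
    Relation.ReflTransGen (Follows σ) (cycleMax σ x) x := by
  obtain ⟨a, -, -, e⟩ := (sameCycle_cycleMax σ x).symm.exists_pow_eq''
  have h : ∀ b : ℕ, Relation.ReflTransGen (Follows σ) (cycleMax σ x)
      ((σ ^ b) (cycleMax σ x)) := by
    intro b
    induction b with
    | zero => exact Relation.ReflTransGen.refl
    | succ b ih =>
      -- When the walk returns to the maximum, the chain starts afresh from the empty one.
      by_cases hb : cycleMax σ ((σ ^ (b + 1)) (cycleMax σ x)) = (σ ^ (b + 1)) (cycleMax σ x)
      · rw [← hb, (cycleMax_eq_iff σ ((σ ^ (b + 1)) (cycleMax σ x)) x).2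
          (Perm.sameCycle_pow_left.2 (sameCycle_cycleMax σ x).symm)]
      · refine ih.tail ⟨?_, hb⟩
        rw [pow_succ', Perm.mul_apply]
  have := h a
  rwa [e] at this

theorem pos_cycleMax_le {n : ℕ} (σ : Perm (Fin n)) (x : Fin n) :
    pos σ (cycleMax σ x) ≤ pos σ x := by
  rcases Relation.reflTransGen_iff_eq_or_transGen.1 (reflTransGen_cycleMax σ x) with h | h
  · rw [← h]
  · exact (pos_lt_of_transGen h).le

/-- This describes the order of the word without numerical positions, so that it can be compared
between `σ` and `detach σ m`. Within one cycle, `Follows` is a partial function, so two chains from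
the common maximum are comparable. -/
theorem pos_lt_iff {n : ℕ} (σ : Perm (Fin n)) (x y : Fin n) :
    pos σ x < pos σ y ↔
      cycleMax σ x < cycleMax σ y ∨ Relation.TransGen (Follows σ) x y := by
  refine ⟨fun h => ?_, fun h => h.elim pos_lt_of_cycleMax_lt pos_lt_of_transGen⟩
  rcases (cycleMax_le_of_pos_lt h).lt_or_eq with hlt | heq
  · exact Or.inl hlt
  right
  have hu : Relator.RightUnique (Follows σ) := fun _ _ _ h₁ h₂ => h₁.1.symm.trans h₂.1
  have hxy := Relation.ReflTransGen.total_of_right_unique hu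
    (reflTransGen_cycleMax σ x) (heq ▸ reflTransGen_cycleMax σ y)
  simp only [Relation.reflTransGen_iff_eq_or_transGen] at hxy
  rcases hxy with (rfl | h') | rfl | h'
  · exact absurd h (lt_irrefl _)
  · exact h'
  · exact absurd h (lt_irrefl _)
  · exact absurd (pos_lt_of_transGen h') h.asymm

/-- Letters adjacent in the standard representation belong to one cycle, or the second one
starts a new cycle. -/
theorem pos_eq_add_one {n : ℕ} {σ : Perm (Fin n)} {x y : Fin n} (h : pos σ y = pos σ x + 1) :
    σ x = y ∨ cycleMax σ y = y ∧ σ x = cycleMax σ x ∧ cycleMax σ x < y := by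
  by_cases hy : cycleMax σ y = y
  · right
    have hx : σ x = cycleMax σ x := by
      by_contra hx
      have hx' : cycleMax σ (σ x) ≠ σ x := by rw [cycleMax_apply]; exact fun e => hx e.symm
      have e : σ x = y := pos_injective σ ((pos_apply hx').trans h.symm)
      exact hx' (e ▸ hy)
    refine ⟨hy, hx, ?_⟩
    rcases (cycleMax_le_of_pos_lt (σ := σ) (x := x) (y := y) (by omega)).lt_or_eq with h' | h'
    · rwa [hy] at h'
    · have := pos_cycleMax_le σ x
      rw [h', hy] at this
      omega
  · left
    obtain ⟨w, rfl⟩ := σ.surjective y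
    have e := pos_apply hy
    rw [pos_injective σ (show pos σ x = pos σ w by omega)]

/-! ### Crossings out of order -/

/-- Two crossing ascents, the higher of which comes first. -/
def AscentCrossing {n : ℕ} (σ : Perm (Fin n)) : Prop :=
  ∃ x y, x < y ∧ y < σ x ∧ σ x < σ y ∧ pos σ y < pos σ x

/-- Two crossing descents, the lower of which comes first. -/
def DescentCrossing {n : ℕ} (σ : Perm (Fin n)) : Prop :=
  ∃ x z, σ x < σ z ∧ σ z < x ∧ x < z ∧ pos σ x < pos σ z

/-- The permutation obtained from `σ` by deleting `m` from its cycle and making it a fixed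
point. -/
def detach {n : ℕ} (σ : Perm (Fin n)) (m : Fin n) : Perm (Fin n) :=
  swap m (σ m) * σ

theorem detach_apply_self {n : ℕ} (σ : Perm (Fin n)) (m : Fin n) : detach σ m m = m := by
  simp [detach]

theorem detach_apply_of_eq {n : ℕ} {σ : Perm (Fin n)} {m x : Fin n} (h : σ x = m) :
    detach σ m x = σ m := by
  simp [detach, h]

theorem detach_apply_of_ne {n : ℕ} {σ : Perm (Fin n)} {m x : Fin n} (hx : x ≠ m)
    (h : σ x ≠ m) : detach σ m x = σ x := by
  simp only [detach, Perm.mul_apply]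
  exact swap_apply_of_ne_of_ne h fun e => hx (σ.injective e)

/-- On a finite set natural powers of `σ` already exhaust a cycle, so `r` need not be symmetric. -/
theorem rel_of_sameCycle {n : ℕ} {σ : Perm (Fin n)} {r : Fin n → Fin n → Prop}
    (hrefl : ∀ x, r x x) (htrans : ∀ x y z, r x y → r y z → r x z) (hσ : ∀ x, r x (σ x))
    {x y : Fin n} (h : σ.SameCycle x y) : r x y := by
  obtain ⟨a, -, -, rfl⟩ := h.exists_pow_eq''
  induction a with
  | zero => exact hrefl x
  | succ a ih =>
    rw [pow_succ', Perm.mul_apply]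
    exact htrans _ _ _ (ih (by simp [Perm.SameCycle.refl])) (hσ _)

theorem sameCycle_of_detach {n : ℕ} {σ : Perm (Fin n)} {m x y : Fin n}
    (h : (detach σ m).SameCycle x y) : σ.SameCycle x y := by
  refine rel_of_sameCycle (r := σ.SameCycle) (Perm.SameCycle.refl σ)
    (fun x y z => Perm.SameCycle.trans) (fun x => ?_) h
  by_cases hx : x = m
  · rw [hx, detach_apply_self]
  by_cases hx' : σ x = m
  · rw [detach_apply_of_eq hx', ← hx', Perm.sameCycle_apply_right, Perm.sameCycle_apply_right]
  · rw [detach_apply_of_ne hx hx', Perm.sameCycle_apply_right]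

theorem sameCycle_detach_iff {n : ℕ} {σ : Perm (Fin n)} {m x y : Fin n} (hx : x ≠ m)
    (hy : y ≠ m) : (detach σ m).SameCycle x y ↔ σ.SameCycle x y := by
  refine ⟨sameCycle_of_detach, fun h => ?_⟩
  -- Contracting `m` onto its successor turns each arc of `σ` into an arc of `detach σ m` or a
  -- trivial step.
  let f : Fin n → Fin n := fun x => if x = m then σ m else x
  have hf : ∀ x, x ≠ m → f x = x := fun x hx => if_neg hx
  have hm : f m = σ m := if_pos rfl
  have := rel_of_sameCycle (r := fun x y => (detach σ m).SameCycle (f x) (f y))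
    (fun _ => Perm.SameCycle.refl _ _) (fun x y z => Perm.SameCycle.trans) (fun x => ?_) h
  · rwa [hf x hx, hf y hy] at this
  by_cases hx : x = m
  · by_cases hs : σ m = m
    · rw [hx, hs]
    · rw [hx, hm, hf _ hs]
  by_cases hx' : σ x = m
  · rw [hx', hf x hx, hm, ← detach_apply_of_eq hx', Perm.sameCycle_apply_right]
  · rw [hf x hx, hf _ hx', ← detach_apply_of_ne hx hx', Perm.sameCycle_apply_right]

theorem cycleMax_detach_self {n : ℕ} (σ : Perm (Fin n)) (m : Fin n) :
    cycleMax (detach σ m) m = m :=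
  (Perm.SameCycle.eq_of_left (sameCycle_cycleMax (detach σ m) m) (detach_apply_self σ m)).symm

/-! ### The smallest moved letter and the order of the word. -/

section Detach

variable {n : ℕ} {σ : Perm (Fin n)} {m : Fin n} (hfix : ∀ x < m, σ x = x) (hm : σ m ≠ m)
include hfix

theorem le_of_apply_ne {x : Fin n} (h : σ x ≠ x) : m ≤ x :=
  not_lt.1 fun h' => h (hfix x h')

theorem le_apply {x : Fin n} (h : m ≤ x) : m ≤ σ x :=
  not_lt.1 fun h' => (σ.injective (hfix _ h') ▸ h').not_ge h

include hm

theorem lt_apply_self : m < σ m :=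
  lt_of_le_of_ne (le_apply hfix le_rfl) hm.symm

theorem lt_of_apply_eq {j : Fin n} (hj : σ j = m) : m < j :=
  lt_of_le_of_ne (le_of_apply_ne hfix fun h => hm (h.symm.trans hj ▸ h))
    fun h => hm (by rwa [← h] at hj)

theorem cycleMax_ne_self : cycleMax σ m ≠ m := fun h =>
  (lt_apply_self hfix hm).not_ge ((apply_le_cycleMax σ m).trans h.le)

theorem pos_of_apply_eq {j : Fin n} (hj : σ j = m) : pos σ m = pos σ j + 1 := by
  subst hj
  exact pos_apply (cycleMax_ne_self hfix hm)

theorem cycleMax_detach {x : Fin n} (hx : x ≠ m) : cycleMax (detach σ m) x = cycleMax σ x := by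
  refine le_antisymm (le_cycleMax_of_sameCycle
    (sameCycle_of_detach (sameCycle_cycleMax _ x))) (le_cycleMax_of_sameCycle ?_)
  refine (sameCycle_detach_iff hx fun h => ?_).2 (sameCycle_cycleMax σ x)
  have := cycleMax_cycleMax σ x
  rw [h] at this
  exact cycleMax_ne_self hfix hm this

theorem pos_lt_of_pos_detach_lt {x y : Fin n} (hx : x ≠ m) (hy : y ≠ m)
    (h : pos (detach σ m) x < pos (detach σ m) y) : pos σ x < pos σ y := by
  rw [pos_lt_iff] at h ⊢
  rw [cycleMax_detach hfix hm hx, cycleMax_detach hfix hm hy] at h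
  refine h.imp_right fun h => ?_
  -- Each step of the detached word is a step of the old word, or two steps passing through `m`.
  suffices key : ∀ a b, Follows (detach σ m) a b → Relation.TransGen (Follows σ) a b from
    Relation.TransGen.closed key _ _ h
  intro a b hab
  obtain ⟨e, hb⟩ := hab
  by_cases ha : a = m
  · subst ha
    rw [detach_apply_self] at e
    subst e
    exact absurd (cycleMax_detach_self σ a) hb
  have hbm : b ≠ m := by
    rintro rfl
    exact ha ((detach σ b).injective (e.trans (detach_apply_self σ b).symm))
  rw [cycleMax_detach hfix hm hbm] at hb
  by_cases ha' : σ a = m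
  · rw [detach_apply_of_eq ha'] at e
    exact (Relation.TransGen.single ⟨ha', cycleMax_ne_self hfix hm⟩).tail ⟨e, hb⟩
  · rw [detach_apply_of_ne ha ha'] at e
    exact .single ⟨e, hb⟩

theorem pos_detach_lt_iff {x y : Fin n} (hx : x ≠ m) (hy : y ≠ m) :
    pos (detach σ m) x < pos (detach σ m) y ↔ pos σ x < pos σ y := by
  refine ⟨pos_lt_of_pos_detach_lt hfix hm hx hy, fun h => ?_⟩
  rcases lt_trichotomy (pos (detach σ m) x) (pos (detach σ m) y) with h' | h' | h'
  · exact h'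
  · exact absurd (congrArg (pos σ) (pos_injective _ h')) h.ne
  · exact absurd (pos_lt_of_pos_detach_lt hfix hm hy hx h') h.asymm

/-- If a letter `i < j` occurs after `m`, where `j → m → k` and `j ≤ k`, then the word descends
across `j` after `m`. -/
theorem exists_descent_across {i j : Fin n} (hj : σ j = m) (hjk : j ≤ σ m)
    (hi : pos σ m < pos σ i) (hij : i < j) :
    ∃ h, j < h ∧ σ h < j ∧ pos σ j < pos σ h := by
  have hpm := pos_of_apply_eq hfix hm hj
  -- Take the earliest letter below `j` after `m`. It starts no cycle, since cycle maxima from here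
  -- on are at least `j`; its predecessor is therefore the required `h`.
  obtain ⟨h', hh', hmin⟩ := ({x | pos σ m < pos σ x ∧ x < j} : Finset (Fin n)).exists_min_image
    (pos σ) ⟨i, by simp [hi, hij]⟩
  simp only [Finset.mem_filter, Finset.mem_univ, true_and] at hh' hmin
  obtain ⟨h, rfl⟩ := σ.surjective h'
  have hrec : cycleMax σ (σ h) ≠ σ h := fun e => by
    have h1 := cycleMax_le_of_pos_lt hh'.1
    rw [e, ← hj, cycleMax_apply] at h1
    exact ((le_cycleMax σ j).trans h1).not_gt hh'.2
  have hp := pos_apply hrec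
  have hne : h ≠ m := fun e => by subst e; exact hh'.2.not_ge hjk
  have hlt : pos σ m < pos σ h :=
    lt_of_le_of_ne (by omega) fun e => hne (pos_injective σ e).symm
  refine ⟨h, lt_of_le_of_ne ?_ ?_, hh'.2, by omega⟩
  · by_contra hc
    have := hmin h ⟨hlt, not_le.1 hc⟩
    omega
  · rintro rfl
    omega

/-- If a descent across `k` occurs before `j`, where `j → m → k` and `k ≤ j`, then some arc
ascends across `k` before `m`. -/
theorem exists_ascent_across {h j : Fin n} (hj : σ j = m) (hkj : σ m ≤ j)
    (hh : pos σ h < pos σ j) (h1 : σ h < σ m) (h2 : σ m < h) :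
    ∃ p, p < σ m ∧ σ m < σ p ∧ pos σ p < pos σ m := by
  have hpm := pos_of_apply_eq hfix hm hj
  have hrec : cycleMax σ (σ h) ≠ σ h := fun e => by
    have := le_cycleMax σ h
    rw [← cycleMax_apply, e] at this
    exact (this.trans_lt h1).asymm h2
  have hp := pos_apply hrec
  have hmem : pos σ (σ h) < pos σ m ∧ σ h < σ m := ⟨by omega, h1⟩
  -- Take the last letter `p` below `k` before `m`. If `p` closes its cycle, `σ p` is a maximum at
  -- least `h > k`; otherwise `σ p` is the next letter, and it is not `m` because `p < k ≤ j`.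
  obtain ⟨p, hp', hmax⟩ := ({x | pos σ x < pos σ m ∧ x < σ m} : Finset (Fin n)).exists_max_image
    (pos σ) ⟨σ h, by simpa using hmem⟩
  simp only [Finset.mem_filter, Finset.mem_univ, true_and] at hp' hmax
  have hpm' : p ≠ m := by rintro rfl; exact lt_irrefl _ hp'.1
  refine ⟨p, hp'.2, lt_of_le_of_ne ?_ fun e => hpm' (σ.injective e.symm), hp'.1⟩
  have hle := hmax _ hmem
  by_cases hr : cycleMax σ (σ p) = σ p
  · have hc := cycleMax_le_of_pos_lt (σ := σ) (x := h) (y := p) (by omega)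
    rw [← cycleMax_apply σ p, hr] at hc
    exact h2.le.trans ((le_cycleMax σ h).trans hc)
  · have hpp := pos_apply hr
    by_contra hc
    rcases (show pos σ (σ p) ≤ pos σ m by omega).lt_or_eq with hlt | heq
    · have := hmax _ ⟨hlt, not_le.1 hc⟩
      omega
    · have e := pos_injective σ heq
      have : p = j := σ.injective (e.trans hj.symm)
      subst this
      exact hkj.not_gt hp'.2

end Detach

/-- An arc of `detach σ m` that jumps, in the direction from `j` to `k`, over the interval
between `j` and `k`, where `j → m → k`. -/
def IsJumpedOver {n : ℕ} (σ : Perm (Fin n)) (m j : Fin n) : Prop :=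
  (j ≤ σ m ∧ ∃ q, m < q ∧ q < j ∧ σ m < σ q) ∨ (σ m ≤ j ∧ ∃ h, j < h ∧ σ h < σ m)

/-! ### Crossings before and after detaching. -/

section Detach

variable {n : ℕ} {σ : Perm (Fin n)} {m j : Fin n} (hfix : ∀ x < m, σ x = x) (hm : σ m ≠ m)
  (hj : σ j = m)
include hfix hm hj

/-- The jumping arc, or an arc found by `exists_descent_across` or `exists_ascent_across`, crosses
`m → k` or `j → m`; which one depends on where the jump sits in the word. -/
theorem crossing_of_isJumpedOver (h : IsJumpedOver σ m j) :
    AscentCrossing σ ∨ DescentCrossing σ := by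
  have hmj := lt_of_apply_eq hfix hm hj
  have hpm := pos_of_apply_eq hfix hm hj
  rcases h with ⟨hjk, q, hmq, hqj, hkq⟩ | ⟨hkj, h, hjh, hhk⟩
  · rcases lt_or_ge (pos σ q) (pos σ m) with hq | hq
    · exact .inl ⟨m, q, hmq, hqj.trans_le hjk, hkq, hq⟩
    · have hq' : pos σ m < pos σ q :=
        lt_of_le_of_ne hq fun e => hmq.ne (pos_injective σ e)
      obtain ⟨h, hjh, hhj, hp⟩ := exists_descent_across hfix hm hj hjk hq' hqj
      refine .inr ⟨j, h, ?_, hhj, hjh, hp⟩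
      rw [hj]
      exact lt_of_le_of_ne (le_apply hfix (hmj.trans hjh).le)
        fun e => hjh.ne (σ.injective (hj.trans e))
  · rcases lt_or_ge (pos σ h) (pos σ j) with hp | hp
    · obtain ⟨p, hpk, hkp, hp⟩ := exists_ascent_across hfix hm hj hkj hp hhk (hkj.trans_lt hjh)
      refine .inl ⟨m, p, ?_, hpk, hkp, hp⟩
      exact lt_of_le_of_ne (le_of_apply_ne hfix (hpk.trans hkp).ne') fun e => by simp [e] at hp
    · refine .inr ⟨j, h, ?_, hhk.trans_le hkj, hjh,
        lt_of_le_of_ne hp fun e => hjh.ne (pos_injective σ e)⟩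
      rw [hj]
      exact lt_of_le_of_ne (le_apply hfix (hmj.trans hjh).le)
        fun e => hjh.ne (σ.injective (hj.trans e))

/-- Only the new arc `j → k` matters. As the lower ascent it is replaced by `m → k`. As the upper
one it puts a letter below `j` after `m`, which yields a descent crossing `j → m`. -/
theorem crossing_of_ascentCrossing_detach (h : AscentCrossing (detach σ m)) :
    AscentCrossing σ ∨ DescentCrossing σ := by
  have hmj := lt_of_apply_eq hfix hm hj
  have hpm := pos_of_apply_eq hfix hm hj
  obtain ⟨x, y, hxy, h1, h2, hp⟩ := h
  have hxm : x ≠ m := by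
    rintro rfl
    rw [detach_apply_self] at h1
    exact hxy.asymm h1
  have hym : y ≠ m := by
    rintro rfl
    rw [detach_apply_self] at h2
    exact h1.asymm h2
  rw [pos_detach_lt_iff hfix hm hym hxm] at hp
  by_cases hxj : x = j
  · subst hxj
    have hyx : σ y ≠ m := fun e => hxy.ne (σ.injective (hj.trans e.symm))
    rw [detach_apply_of_eq hj] at h1 h2
    rw [detach_apply_of_ne hym hyx] at h2
    exact .inl ⟨m, y, hmj.trans hxy, h1, h2, by omega⟩
  have hx' : σ x ≠ m := fun e => hxj (σ.injective (e.trans hj.symm))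
  rw [detach_apply_of_ne hxm hx'] at h1 h2
  by_cases hyj : y = j
  · subst hyj
    rw [detach_apply_of_eq hj] at h2
    have hpx : pos σ m ≠ pos σ x := fun e => hxm (pos_injective σ e).symm
    obtain ⟨h, hjh, hhj, hp⟩ := exists_descent_across hfix hm hj (h1.trans h2).le
      (show pos σ m < pos σ x by omega) hxy
    refine .inr ⟨y, h, ?_, hhj, hjh, hp⟩
    rw [hj]
    exact lt_of_le_of_ne (le_apply hfix (hmj.trans hjh).le)
      fun e => hjh.ne (σ.injective (hj.trans e))
  have hy' : σ y ≠ m := fun e => hyj (σ.injective (e.trans hj.symm))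
  rw [detach_apply_of_ne hym hy'] at h2
  exact .inl ⟨x, y, hxy, h1, h2, hp⟩

/-- As the lower descent, `j → k` is replaced by `j → m`. As the upper one, it follows a descent
across `k`, which forces an earlier ascent crossing `m → k`. -/
theorem crossing_of_descentCrossing_detach (h : DescentCrossing (detach σ m)) :
    AscentCrossing σ ∨ DescentCrossing σ := by
  have hmj := lt_of_apply_eq hfix hm hj
  have hpm := pos_of_apply_eq hfix hm hj
  have hmk := lt_apply_self hfix hm
  obtain ⟨x, z, h1, h2, hxz, hp⟩ := h
  have hxm : x ≠ m := by
    rintro rfl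
    rw [detach_apply_self] at h1
    exact h1.asymm h2
  have hzm : z ≠ m := by
    rintro rfl
    rw [detach_apply_self] at h2
    exact h2.asymm hxz
  rw [pos_detach_lt_iff hfix hm hxm hzm] at hp
  by_cases hxj : x = j
  · subst hxj
    have hzx : σ z ≠ m := fun e => hxz.ne (σ.injective (hj.trans e.symm))
    rw [detach_apply_of_eq hj] at h1
    rw [detach_apply_of_ne hzm hzx] at h1 h2
    exact .inr ⟨x, z, hj ▸ hmk.trans h1, h2, hxz, hp⟩
  have hx' : σ x ≠ m := fun e => hxj (σ.injective (e.trans hj.symm))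
  rw [detach_apply_of_ne hxm hx'] at h1
  by_cases hzj : z = j
  · subst hzj
    rw [detach_apply_of_eq hj] at h1 h2
    obtain ⟨p, hpk, hkp, hp⟩ := exists_ascent_across hfix hm hj (h2.trans hxz).le hp h1 h2
    refine .inl ⟨m, p, ?_, hpk, hkp, hp⟩
    exact lt_of_le_of_ne (le_of_apply_ne hfix (hpk.trans hkp).ne') fun e => by simp [e] at hp
  have hz' : σ z ≠ m := fun e => hzj (σ.injective (e.trans hj.symm))
  rw [detach_apply_of_ne hzm hz'] at h1 h2
  exact .inr ⟨x, z, h1, h2, hxz, hp⟩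

/-- The only arc at risk is `m → k` as the lower ascent, because `j` descends. If `j < y`, then `j →
k` takes its place; the remaining cases produce a jump or a descent crossing. -/
theorem crossing_detach_of_ascentCrossing (h : AscentCrossing σ) :
    AscentCrossing (detach σ m) ∨ DescentCrossing (detach σ m) ∨ IsJumpedOver σ m j := by
  have hmj := lt_of_apply_eq hfix hm hj
  have hpm := pos_of_apply_eq hfix hm hj
  have hmk := lt_apply_self hfix hm
  have hjm' := detach_apply_of_eq hj
  obtain ⟨x, y, hxy, h1, h2, hp⟩ := h
  have hmx : m ≤ x := le_of_apply_ne hfix (hxy.trans h1).ne'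
  have hym : y ≠ m := (hmx.trans_lt hxy).ne'
  have hyj : y ≠ j := by
    rintro rfl
    rw [hj] at h2
    exact (hmx.trans_lt hxy).asymm (h1.trans h2)
  have hy' : σ y ≠ m := fun e => hyj (σ.injective (e.trans hj.symm))
  by_cases hxm : x = m
  · subst hxm
    have hpyj : pos σ y < pos σ j := by
      have : pos σ y ≠ pos σ j := fun e => hyj (pos_injective σ e)
      omega
    rcases lt_or_gt_of_ne hyj with hlt | hlt
    · rcases le_or_gt j (σ x) with hjk | hkj
      · exact .inr (.inr (.inl ⟨hjk, y, hxy, hlt, h2⟩))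
      have hkrec : cycleMax σ (σ x) ≠ σ x := fun e => by
        rw [cycleMax_apply, ← hj, cycleMax_apply, hj] at e
        exact (le_cycleMax σ j).not_gt (e ▸ hkj)
      have hpk := pos_apply hkrec
      -- Here `y < k < j`. The first letter below `k` in the cycle of `y` is not its maximum, so it
      -- is reached by a descent `h → σ h` across `k`. For `h > j` this is a jump; for `h < j` it
      -- crosses `j → k`.
      obtain ⟨h', hh', hmin⟩ :=
        ({u | cycleMax σ u = cycleMax σ y ∧ u < σ x} : Finset (Fin n)).exists_min_image
        (pos σ) ⟨y, by simp [h1]⟩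
      simp only [Finset.mem_filter, Finset.mem_univ, true_and] at hh' hmin
      have hpy := hmin y ⟨rfl, h1⟩
      obtain ⟨h, rfl⟩ := σ.surjective h'
      have hrec : cycleMax σ (σ h) ≠ σ h := fun e => by
        rw [hh'.1] at e
        exact (h2.trans_le (apply_le_cycleMax σ y)).asymm (e ▸ hh'.2)
      have hph := pos_apply hrec
      have hkh : σ x < h := by
        refine lt_of_le_of_ne ?_ ?_
        · by_contra hc
          have := hmin h ⟨(cycleMax_apply σ h).symm.trans hh'.1, not_le.1 hc⟩
          omega
        · rintro rfl
          omega
      rcases lt_trichotomy j h with hjh | rfl | hhj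
      · exact .inr (.inr (.inr ⟨hkj.le, h, hjh, hh'.2⟩))
      · omega
      · refine .inr (.inl ⟨h, j, ?_, ?_, hhj, ?_⟩)
        · rw [hjm', detach_apply_of_ne (hmk.trans hkh).ne'
            fun e => hhj.ne (σ.injective (e.trans hj.symm))]
          exact hh'.2
        · rwa [hjm']
        · rw [pos_detach_lt_iff hfix hm (hmk.trans hkh).ne' hmj.ne']
          omega
    · refine .inl ⟨j, y, hlt, ?_, ?_, ?_⟩
      · rwa [hjm']
      · rwa [hjm', detach_apply_of_ne hym hy']
      · rwa [pos_detach_lt_iff hfix hm hym hmj.ne']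
  · have hxj : x ≠ j := by
      rintro rfl
      rw [hj] at h1
      exact (hmx.trans_lt hxy).asymm h1
    have hx' : σ x ≠ m := fun e => hxj (σ.injective (e.trans hj.symm))
    refine .inl ⟨x, y, hxy, ?_, ?_, ?_⟩
    · rwa [detach_apply_of_ne hxm hx']
    · rwa [detach_apply_of_ne hxm hx', detach_apply_of_ne hym hy']
    · rwa [pos_detach_lt_iff hfix hm hym hxm]

theorem crossing_detach_of_descentCrossing (h : DescentCrossing σ) :
    AscentCrossing (detach σ m) ∨ DescentCrossing (detach σ m) ∨ IsJumpedOver σ m j := by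
  have hmj := lt_of_apply_eq hfix hm hj
  have hpm := pos_of_apply_eq hfix hm hj
  have hjm' := detach_apply_of_eq hj
  obtain ⟨x, z, h1, h2, hxz, hp⟩ := h
  have hmz : m ≤ σ z := le_apply hfix (le_of_apply_ne hfix (h2.trans hxz).ne)
  have hxm : x ≠ m := (hmz.trans_lt h2).ne'
  have hzm : z ≠ m := ((hmz.trans_lt h2).trans hxz).ne'
  have hzj : z ≠ j := by
    rintro rfl
    exact (le_apply hfix (hmz.trans h2.le)).not_gt (hj ▸ h1)
  have hz' : σ z ≠ m := fun e => hzj (σ.injective (e.trans hj.symm))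
  by_cases hxj : x = j
  · subst hxj
    have hzk : σ z ≠ σ m := fun e => hzm (σ.injective e)
    rcases lt_or_gt_of_ne hzk with hlt | hlt
    · rcases le_or_gt (σ m) x with hkj | hjk
      · exact .inr (.inr (.inr ⟨hkj, z, hxz, hlt⟩))
      have hrec : cycleMax σ (σ z) ≠ σ z := fun e => by
        rw [cycleMax_apply] at e
        exact (le_cycleMax σ z).not_gt (e ▸ h2.trans hxz)
      have hpz := pos_apply hrec
      -- Here `σ z < j < k`. The last letter `i` below `j` in the cycle of `z` ascends across `j`:
      -- to the next letter, or to the maximum, which is at least `z`. Its arc crosses `j → k` if `σ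
      -- i < k` and jumps if `σ i > k`.
      obtain ⟨i, hi, hmax⟩ :=
        ({u | cycleMax σ u = cycleMax σ z ∧ u < x} : Finset (Fin n)).exists_max_image
        (pos σ) ⟨σ z, by simp [h2, cycleMax_apply]⟩
      simp only [Finset.mem_filter, Finset.mem_univ, true_and] at hi hmax
      have hpi := hmax (σ z) ⟨cycleMax_apply σ z, h2⟩
      have him : i ≠ m := by
        rintro rfl
        have : pos σ i ≠ pos σ z := fun e => hzm (pos_injective σ e).symm
        omega
      have hxi : x < σ i := by
        by_cases hir : cycleMax σ (σ i) = σ i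
        · rw [← hir, cycleMax_apply, hi.1]
          exact hxz.trans_le (le_cycleMax σ z)
        have hpi' := pos_apply hir
        refine lt_of_le_of_ne ?_ ?_
        · by_contra hc
          have := hmax (σ i) ⟨(cycleMax_apply σ i).trans hi.1, not_le.1 hc⟩
          omega
        · intro e
          rw [← e] at hpi'
          omega
      have hmi : m < i :=
        lt_of_le_of_ne (le_of_apply_ne hfix (hi.2.trans hxi).ne') him.symm
      rcases lt_trichotomy (σ i) (σ m) with hik | hik | hik
      · refine .inl ⟨i, x, hi.2, ?_, ?_, ?_⟩
        · rwa [detach_apply_of_ne him (hmj.trans hxi).ne']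
        · rwa [hjm', detach_apply_of_ne him (hmj.trans hxi).ne']
        · rw [pos_detach_lt_iff hfix hm hxm him]
          omega
      · exact absurd (σ.injective hik) him
      · exact .inr (.inr (.inl ⟨hjk.le, i, hmi, hi.2, hik⟩))
    · refine .inr (.inl ⟨x, z, ?_, ?_, hxz, ?_⟩)
      · rwa [hjm', detach_apply_of_ne hzm hz']
      · rwa [detach_apply_of_ne hzm hz']
      · rwa [pos_detach_lt_iff hfix hm hxm hzm]
  · have hx' : σ x ≠ m := fun e => hxj (σ.injective (e.trans hj.symm))
    refine .inr (.inl ⟨x, z, ?_, ?_, hxz, ?_⟩)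
    · rwa [detach_apply_of_ne hxm hx', detach_apply_of_ne hzm hz']
    · rwa [detach_apply_of_ne hzm hz']
    · rwa [pos_detach_lt_iff hfix hm hxm hzm]

theorem crossing_iff_detach : AscentCrossing σ ∨ DescentCrossing σ ↔
    (AscentCrossing (detach σ m) ∨ DescentCrossing (detach σ m)) ∨ IsJumpedOver σ m j := by
  refine ⟨fun h => or_assoc.2 (h.elim (crossing_detach_of_ascentCrossing hfix hm hj)
    (crossing_detach_of_descentCrossing hfix hm hj)), ?_⟩
  rintro ((h | h) | h)
  · exact crossing_of_ascentCrossing_detach hfix hm hj h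
  · exact crossing_of_descentCrossing_detach hfix hm hj h
  · exact crossing_of_isJumpedOver hfix hm hj h

end Detach

/-! ### Length and inversions -/

/-- The exhibited word also makes the set of lengths nonempty, excluding the default value `0` of
`sInf ∅`. -/
theorem wordLength_eq {G : Type*} [Group G] {A : Set G} {g : G} {c : ℕ}
    (h : ∃ l : List G, (∀ a ∈ l, a ∈ A) ∧ l.prod = g ∧ l.length ≤ c)
    (h' : ∀ l : List G, (∀ a ∈ l, a ∈ A) → l.prod = g → c ≤ l.length) :
    wordLength A g = c := by
  obtain ⟨l, hl, hg, hc⟩ := h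
  have hle : wordLength A g ≤ l.length := Nat.sInf_le ⟨l, hl, hg, rfl⟩
  refine le_antisymm (hle.trans hc) (le_csInf ⟨l.length, l, hl, hg, rfl⟩ ?_)
  rintro k ⟨l, hl, hg, rfl⟩
  exact h' l hl hg

/-- The inversions of `σ`, as pairs of positions. -/
def inversions {n : ℕ} (σ : Perm (Fin n)) : Finset (Fin n × Fin n) :=
  {p | p.1 < p.2 ∧ σ p.2 < σ p.1}

theorem mem_inversions {n : ℕ} (σ : Perm (Fin n)) (p q : Fin n) :
    (p, q) ∈ inversions σ ↔ p < q ∧ σ q < σ p := by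
  simp [inversions]

theorem eq_of_swap_lt_swap {n : ℕ} {i j u v : Fin n} (hij : (j : ℕ) = i + 1) (huv : u < v)
    (h : swap i j v < swap i j u) : u = i ∧ v = j := by
  simp only [swap_apply_def] at h
  simp only [Fin.ext_iff, Fin.lt_def] at *
  split_ifs at h <;> omega

theorem card_inversions_swap_mul_le {n : ℕ} {i j : Fin n} (hij : (j : ℕ) = i + 1)
    (σ : Perm (Fin n)) : (inversions (swap i j * σ)).card ≤ (inversions σ).card + 1 := by
  refine (Finset.card_le_card (t := insert (σ.symm i, σ.symm j) (inversions σ)) ?_).trans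
    (Finset.card_insert_le _ _)
  rintro ⟨p, q⟩ h
  rw [mem_inversions] at h
  rw [Finset.mem_insert, mem_inversions]
  rcases lt_or_gt_of_ne (σ.injective.ne h.1.ne) with hlt | hlt
  · obtain ⟨h1, h2⟩ := eq_of_swap_lt_swap hij hlt h.2
    left
    rw [← h1, ← h2, symm_apply_apply, symm_apply_apply]
  · exact .inr ⟨h.1, hlt⟩

theorem card_inversions_swap_mul_lt {n : ℕ} {i j : Fin n} (hij : (j : ℕ) = i + 1)
    {σ : Perm (Fin n)} (hσ : σ.symm j < σ.symm i) :
    (inversions (swap i j * σ)).card < (inversions σ).card := by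
  refine Finset.card_lt_card (Finset.ssubset_iff_of_subset ?_ |>.2
    ⟨(σ.symm j, σ.symm i), ?_, ?_⟩)
  · rintro ⟨p, q⟩ h
    rw [mem_inversions] at h ⊢
    rcases lt_or_gt_of_ne (σ.injective.ne h.1.ne) with hlt | hlt
    · obtain ⟨h1, h2⟩ := eq_of_swap_lt_swap hij hlt h.2
      rw [← h1, ← h2, symm_apply_apply, symm_apply_apply] at hσ
      exact absurd h.1 hσ.asymm
    · exact ⟨h.1, hlt⟩
  · rw [mem_inversions, apply_symm_apply, apply_symm_apply, Fin.lt_def, Fin.lt_def]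
    exact ⟨hσ, by omega⟩
  · rw [mem_inversions]
    simp only [Perm.mul_apply, apply_symm_apply, swap_apply_left, swap_apply_right]
    rw [Fin.lt_def (a := j)]
    omega

theorem exists_adjacent_descent {n : ℕ} {σ : Perm (Fin n)} (hσ : σ ≠ 1) :
    ∃ i j : Fin n, (j : ℕ) = i + 1 ∧ σ j < σ i := by
  by_contra! hc
  refine hσ ?_
  have hmono : StrictMono σ := by
    cases n with
    | zero => exact fun a => a.elim0
    | succ n =>
      exact Fin.strictMono_iff_lt_succ.2 fun i =>
        lt_of_le_of_ne (hc i.castSucc i.succ (by simp)) (σ.injective.ne (Fin.castSucc_lt_succ).ne)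
  have := (StrictMono.range_inj hmono strictMono_id).1 (by simp [σ.surjective.range_eq])
  exact Equiv.ext fun x => congrFun this x

theorem lengthS_eq {n : ℕ} (σ : Perm (Fin n)) : lengthS σ = (inversions σ).card := by
  refine wordLength_eq ?_ ?_
  · induction hN : (inversions σ).card using Nat.strong_induction_on generalizing σ with
    | _ N ih =>
      by_cases hσ : σ = 1
      · exact ⟨[], by simp, by simp [hσ], by simp⟩
      -- Left multiplication swaps adjacent values, so the descent is sought in the inverse.
      obtain ⟨i, j, hij, h⟩ := exists_adjacent_descent (σ := σ⁻¹) (by simpa using hσ)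
      have hlt := card_inversions_swap_mul_lt hij h
      obtain ⟨l, hl, hp, hlen⟩ := ih _ (hN ▸ hlt) (swap i j * σ) rfl
      refine ⟨swap i j :: l, ?_, ?_, ?_⟩
      · intro a ha
        rcases List.mem_cons.1 ha with rfl | ha
        · exact ⟨i, j, hij, rfl⟩
        · exact hl a ha
      · rw [List.prod_cons, hp, swap_mul_self_mul]
      · rw [List.length_cons]
        omega
  · intro l hl hp
    subst hp
    induction l with
    | nil =>
      refine (Finset.card_eq_zero.2 (Finset.eq_empty_of_forall_notMem ?_)).le
      rintro ⟨p, q⟩ h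
      rw [mem_inversions] at h
      exact h.1.asymm h.2
    | cons s l ih =>
      obtain ⟨i, j, hij, rfl⟩ := hl s (by simp)
      have := ih fun a ha => hl a (by simp [ha])
      have := card_inversions_swap_mul_le hij l.prod
      rw [List.prod_cons, List.length_cons]
      omega

/-! ### Reflection length and cycles -/

theorem mem_reflections_iff {n : ℕ} (t : Perm (Fin n)) :
    t ∈ reflections n ↔ ∃ a b, a ≠ b ∧ t = swap a b := by
  constructor
  · rintro ⟨s, ⟨i, j, hij, rfl⟩, g, rfl⟩
    refine ⟨g i, g j, g.injective.ne fun e => ?_, ?_⟩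
    · rw [e] at hij
      omega
    · rw [swap_apply_apply]
  · have key : ∀ a b : Fin n, a < b → swap a b ∈ reflections n := by
      intro a b hab
      let c : Fin n := ⟨a + 1, by omega⟩
      have hac : a ≠ c := fun e => by have := congrArg Fin.val e; simp [c] at this
      refine ⟨swap a c, ⟨a, c, rfl, rfl⟩, swap c b, ?_⟩
      rw [← swap_apply_apply, swap_apply_left, swap_apply_of_ne_of_ne hac hab.ne]
    rintro ⟨a, b, hab, rfl⟩
    rcases lt_or_gt_of_ne hab with h | h
    · exact key a b h
    · exact swap_comm a b ▸ key b a h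

/-- The number of cycles of `σ`, fixed points included. -/
noncomputable def numCycles {n : ℕ} (σ : Perm (Fin n)) : ℕ :=
  ({x | cycleMax σ x = x} : Finset (Fin n)).card

/-- A dimension count: a rational function that takes equal values on the two letters of each factor
is constant on the cycles of the product. If it also vanishes at every cycle maximum, it is zero. -/
theorem le_numCycles_add_length {n : ℕ} (l : List (Perm (Fin n)))
    (hl : ∀ t ∈ l, t ∈ reflections n) : n ≤ numCycles l.prod + l.length := by
  have hl' : ∀ i : Fin l.length, ∃ a b, l[i] = swap a b := fun i =>
    let ⟨a, b, _, h⟩ := (mem_reflections_iff _).1 (hl l[i] (List.getElem_mem _))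
    ⟨a, b, h⟩
  choose a b hab using hl'
  set σ := l.prod with hσ
  let F : (Fin n → ℚ) →ₗ[ℚ] ({x // cycleMax σ x = x} → ℚ) × (Fin l.length → ℚ) :=
    { toFun := fun f => (fun x => f x, fun i => f (a i) - f (b i))
      map_add' := fun f g => by ext <;> simp; ring
      map_smul' := fun c f => by ext <;> simp; ring }
  have hF : Function.Injective F := by
    rw [← LinearMap.ker_eq_bot, LinearMap.ker_eq_bot']
    intro f hf
    have h1 : ∀ x, cycleMax σ x = x → f x = 0 := fun x hx =>
      congrFun (congrArg Prod.fst hf) ⟨x, hx⟩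
    have h2 : ∀ i, f (a i) = f (b i) := fun i => sub_eq_zero.1 (congrFun (congrArg Prod.snd hf) i)
    have h3 : ∀ t ∈ l, ∀ x, f (t x) = f x := by
      intro t ht x
      obtain ⟨i, hi, rfl⟩ := List.getElem_of_mem ht
      have e : l[i] = swap (a ⟨i, hi⟩) (b ⟨i, hi⟩) := hab ⟨i, hi⟩
      rw [e, swap_apply_def]
      split_ifs with hx hx
      · rw [hx, h2]
      · rw [hx, h2]
      · rfl
    have h4 : ∀ x, f (σ x) = f x := by
      rw [hσ]
      clear_value σ
      clear hσ hf h1 h2 F a b hab hl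
      induction l with
      | nil => simp
      | cons t l ih =>
        intro x
        rw [List.prod_cons, Perm.mul_apply, h3 t (by simp), ih fun t ht => h3 t (by simp [ht])]
    ext x
    rw [Pi.zero_apply, ← h1 _ (cycleMax_cycleMax σ x)]
    exact rel_of_sameCycle (r := fun x y => f x = f y) (fun _ => rfl) (fun _ _ _ => Eq.trans)
      (fun x => (h4 x).symm) (sameCycle_cycleMax σ x)
  have := LinearMap.finrank_le_finrank_of_injective hF
  rw [Module.finrank_prod, Module.finrank_fintype_fun_eq_card, Module.finrank_fintype_fun_eq_card,
    Module.finrank_fintype_fun_eq_card, Fintype.card_fin, Fintype.card_fin,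
    Fintype.card_subtype] at this
  exact this

/-! ### Detaching the smallest moved letter -/

theorem swap_mul_detach {n : ℕ} (σ : Perm (Fin n)) (m : Fin n) :
    swap m (σ m) * detach σ m = σ :=
  swap_mul_self_mul _ _ _

theorem card_inversions_eq_sum {n : ℕ} (σ : Perm (Fin n)) :
    ((inversions σ).card : ℤ) = ∑ p, ∑ q, if p < q ∧ σ q < σ p then 1 else 0 := by
  rw [← Fintype.sum_prod_type', inversions, Finset.card_filter]
  push_cast
  rfl

/-- This isolates the two rows and columns in which the inversion tables of `σ` and `detach σ m` can
differ. -/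
theorem sum_sum_eq_of_ne {α M : Type*} [Fintype α] [DecidableEq α] [AddCommMonoid M] {a b : α}
    (hab : a ≠ b) (f : α → α → M) :
    ∑ p, ∑ q, f p q = (f a a + f a b + (f b a + f b b)) +
      ∑ q ∈ ({a, b} : Finset α)ᶜ, (f a q + f b q + (f q a + f q b)) +
      ∑ p ∈ ({a, b} : Finset α)ᶜ, ∑ q ∈ ({a, b} : Finset α)ᶜ, f p q := by
  have h : ∀ g : α → M, ∑ q, g q = g a + g b + ∑ q ∈ ({a, b} : Finset α)ᶜ, g q := fun g => by
    rw [← Finset.sum_add_sum_compl {a, b}, Finset.sum_pair hab]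
  simp only [h, Finset.sum_add_distrib]
  abel

section Detach

variable {n : ℕ} {σ : Perm (Fin n)} {m j : Fin n} (hfix : ∀ x < m, σ x = x) (hm : σ m ≠ m)
include hfix hm

theorem numCycles_detach : numCycles (detach σ m) = numCycles σ + 1 := by
  have h : ({x | cycleMax (detach σ m) x = x} : Finset (Fin n)) =
      insert m ({x | cycleMax σ x = x} : Finset (Fin n)) := by
    ext x
    by_cases hx : x = m
    · simp [hx, cycleMax_detach_self]
    · simp [hx, cycleMax_detach hfix hm hx]
  rw [numCycles, h, Finset.card_insert_of_notMem (by simpa using cycleMax_ne_self hfix hm),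
    numCycles]

variable (hj : σ j = m)
include hj

/-- The contribution `k - m` of the ascent at `m` is replaced by `max (k - j) 0` at `j`. -/
theorem depth_detach :
    depth σ = depth (detach σ m) + (min ((σ m : ℕ) : ℤ) ((j : ℕ) : ℤ) - (m : ℕ)) := by
  have hmj := lt_of_apply_eq hfix hm hj
  have hmk := lt_apply_self hfix hm
  simp only [depth, Finset.sum_filter]
  rw [← Finset.sum_add_sum_compl {m, j}, ← Finset.sum_add_sum_compl {m, j} (fun i =>
    if i < detach σ m i then (((detach σ m i : Fin n) : ℕ) : ℤ) - (i : ℕ) else 0),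
    Finset.sum_pair hmj.ne, Finset.sum_pair hmj.ne, detach_apply_self, detach_apply_of_eq hj, hj]
  have : ∀ i ∈ ({m, j} : Finset (Fin n))ᶜ, detach σ m i = σ i := by
    intro i hi
    simp only [Finset.mem_compl, Finset.mem_insert, Finset.mem_singleton, not_or] at hi
    exact detach_apply_of_ne hi.1 fun e => hi.2 (σ.injective (e.trans hj.symm))
  rw [Finset.sum_congr (f := fun i => if i < detach σ m i then _ else _) rfl fun i hi => by
    rw [this i hi]]
  simp only [Fin.lt_def] at *
  split_ifs <;> omega

/-- Detaching exchanges the values `k` and `m` at positions `m` and `j`. That pair loses one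
inversion, and each position between them with a value between `m` and `k` loses two; values there
exceed `m` automatically. -/
theorem card_inversions_detach :
    (inversions σ).card = (inversions (detach σ m)).card + 1 +
      2 * ({q | m < q ∧ q < j ∧ σ q < σ m} : Finset (Fin n)).card := by
  have hmj := lt_of_apply_eq hfix hm hj
  have hmk := lt_apply_self hfix hm
  have hc : (({q | m < q ∧ q < j ∧ σ q < σ m} : Finset (Fin n)).card : ℤ) =
      ∑ q ∈ ({m, j} : Finset (Fin n))ᶜ, if m < q ∧ q < j ∧ σ q < σ m then 1 else 0 := by
    rw [Finset.card_filter, ← Finset.sum_add_sum_compl {m, j}, Finset.sum_pair hmj.ne]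
    simp
  have hne : ∀ q ∈ ({m, j} : Finset (Fin n))ᶜ, q ≠ m ∧ q ≠ j ∧ σ q ≠ m ∧ σ q ≠ σ m := by
    intro q hq
    simp only [Finset.mem_compl, Finset.mem_insert, Finset.mem_singleton, not_or] at hq
    exact ⟨hq.1, hq.2, fun e => hq.2 (σ.injective (e.trans hj.symm)), σ.injective.ne hq.1⟩
  have hd : ∀ q ∈ ({m, j} : Finset (Fin n))ᶜ, detach σ m q = σ q := fun q hq =>
    detach_apply_of_ne (hne q hq).1 (hne q hq).2.2.1
  zify
  rw [card_inversions_eq_sum, card_inversions_eq_sum, hc, sum_sum_eq_of_ne hmj.ne,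
    sum_sum_eq_of_ne hmj.ne, Finset.sum_congr (g := fun p => ∑ q ∈ ({m, j} : Finset (Fin n))ᶜ,
      if p < q ∧ detach σ m q < detach σ m p then (1 : ℤ) else 0) rfl fun p hp =>
      Finset.sum_congr rfl fun q hq => by rw [hd p hp, hd q hq],
    Finset.sum_congr (g := fun q =>
      ((if m < q ∧ detach σ m q < detach σ m m then (1 : ℤ) else 0) +
        (if j < q ∧ detach σ m q < detach σ m j then 1 else 0) +
        ((if q < m ∧ detach σ m m < detach σ m q then 1 else 0) +
        if q < j ∧ detach σ m j < detach σ m q then 1 else 0)) +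
      2 * if m < q ∧ q < j ∧ σ q < σ m then 1 else 0) rfl ?_,
    Finset.sum_add_distrib, ← Finset.mul_sum, detach_apply_self, detach_apply_of_eq hj, hj]
  · simp [hmj, hmk, hmj.asymm, hmk.asymm]
    ring
  · intro q hq
    obtain ⟨h1, h2, h3, h4⟩ := hne q hq
    rw [hd q hq, detach_apply_self, detach_apply_of_eq hj, hj]
    rcases lt_or_gt_of_ne h1 with hqm | hqm
    · rw [hfix q hqm]
      simp [hqm.asymm, hqm, (hqm.trans hmj).asymm, (hqm.trans hmk).asymm]
    · have hle : m < σ q := lt_of_le_of_ne (le_apply hfix hqm.le) (Ne.symm h3)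
      rcases lt_or_gt_of_ne h2 with h2 | h2 <;> rcases lt_or_gt_of_ne h4 with h4 | h4 <;>
        simp [hqm, hqm.asymm, hle, hle.asymm, h2, h2.asymm, h4, h4.asymm]

end Detach

/-! ### The excess and shallowness -/

/-- Twice the depth of `σ`, minus its length, minus its reflection length. -/
noncomputable def excess {n : ℕ} (σ : Perm (Fin n)) : ℤ :=
  2 * depth σ - (inversions σ).card - (n - numCycles σ)

section Detach

variable {n : ℕ} {σ : Perm (Fin n)} {m j : Fin n} (hfix : ∀ x < m, σ x = x) (hm : σ m ≠ m)
  (hj : σ j = m)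
include hfix hm hj

theorem excess_detach : excess σ = excess (detach σ m) +
    2 * (min ((σ m : ℕ) : ℤ) ((j : ℕ) : ℤ) - (m : ℕ) - 1 -
      ({q | m < q ∧ q < j ∧ σ q < σ m} : Finset (Fin n)).card) := by
  rw [excess, excess, numCycles_detach hfix hm, card_inversions_detach hfix hm hj,
    depth_detach hfix hm hj]
  push_cast
  ring

theorem card_add_le_source :
    ({q | m < q ∧ q < j ∧ σ q < σ m} : Finset (Fin n)).card + m + 1 ≤ j ∧
    (({q | m < q ∧ q < j ∧ σ q < σ m} : Finset (Fin n)).card + m + 1 = j ↔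
      ¬ ∃ q, m < q ∧ q < j ∧ σ m < σ q) := by
  have hmj := lt_of_apply_eq hfix hm hj
  set E : Finset (Fin n) := {q | m < q ∧ q < j ∧ σ q < σ m} with hE
  have hsub : E ⊆ Finset.Ioo m j := fun q hq => by
    simp only [hE, Finset.mem_filter, Finset.mem_univ, true_and] at hq
    exact Finset.mem_Ioo.2 ⟨hq.1, hq.2.1⟩
  have hcard : (Finset.Ioo m j).card + m + 1 = j := by
    rw [Fin.card_Ioo]
    rw [Fin.lt_def] at hmj
    omega
  refine ⟨by have := Finset.card_le_card hsub; omega, fun h => ?_, fun h => ?_⟩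
  · rintro ⟨q, h1, h2, h3⟩
    have he := Finset.eq_of_subset_of_card_le hsub (by omega)
    have hq : q ∈ E := he ▸ Finset.mem_Ioo.2 ⟨h1, h2⟩
    simp only [hE, Finset.mem_filter, Finset.mem_univ, true_and] at hq
    exact h3.asymm hq.2.2
  · have he : E = Finset.Ioo m j := hsub.antisymm fun q hq => by
      obtain ⟨h1, h2⟩ := Finset.mem_Ioo.1 hq
      simp only [hE, Finset.mem_filter, Finset.mem_univ, true_and]
      exact ⟨h1, h2, lt_of_le_of_ne (not_lt.1 fun h3 => h ⟨q, h1, h2, h3⟩)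
        (σ.injective.ne h1.ne')⟩
    rw [he, hcard]

/-- Here the values of `E` are counted instead of its positions. A value strictly between `m` and
`k` missing from `σ(E)` must come from a position beyond `j`. -/
theorem card_add_le_target :
    ({q | m < q ∧ q < j ∧ σ q < σ m} : Finset (Fin n)).card + m + 1 ≤ σ m ∧
    (({q | m < q ∧ q < j ∧ σ q < σ m} : Finset (Fin n)).card + m + 1 = σ m ↔
      ¬ ∃ h, j < h ∧ σ h < σ m) := by
  have hmj := lt_of_apply_eq hfix hm hj
  have hmk := lt_apply_self hfix hm
  set E : Finset (Fin n) := {q | m < q ∧ q < j ∧ σ q < σ m} with hE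
  have hgt : ∀ q, m < q → q ≠ j → m < σ q := fun q h1 h2 =>
    lt_of_le_of_ne (le_apply hfix h1.le) fun e => h2 (σ.injective (e.symm.trans hj.symm))
  rw [← Finset.card_image_of_injective E σ.injective]
  have hsub : E.image σ ⊆ Finset.Ioo m (σ m) := fun v hv => by
    obtain ⟨q, hq, rfl⟩ := Finset.mem_image.1 hv
    simp only [hE, Finset.mem_filter, Finset.mem_univ, true_and] at hq
    exact Finset.mem_Ioo.2 ⟨hgt q hq.1 hq.2.1.ne, hq.2.2⟩
  have hcard : (Finset.Ioo m (σ m)).card + m + 1 = σ m := by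
    rw [Fin.card_Ioo]
    rw [Fin.lt_def] at hmk
    omega
  refine ⟨by have := Finset.card_le_card hsub; omega, fun h => ?_, fun h => ?_⟩
  · rintro ⟨q, h1, h2⟩
    have he := Finset.eq_of_subset_of_card_le hsub (by omega)
    have hq : σ q ∈ E.image σ :=
      he ▸ Finset.mem_Ioo.2 ⟨hgt q (hmj.trans h1) h1.ne', h2⟩
    obtain ⟨q', hq', e⟩ := Finset.mem_image.1 hq
    rw [σ.injective e] at hq'
    simp only [hE, Finset.mem_filter, Finset.mem_univ, true_and] at hq'
    exact h1.asymm hq'.2.1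
  · have he : E.image σ = Finset.Ioo m (σ m) := hsub.antisymm fun v hv => by
      obtain ⟨h1, h2⟩ := Finset.mem_Ioo.1 hv
      obtain ⟨q, rfl⟩ := σ.surjective v
      refine Finset.mem_image_of_mem σ ?_
      simp only [hE, Finset.mem_filter, Finset.mem_univ, true_and]
      refine ⟨lt_of_le_of_ne (not_lt.1 fun hq => ?_) ?_, lt_of_le_of_ne
        (not_lt.1 fun hq => h ⟨q, hq, h2⟩) ?_, h2⟩
      · rw [hfix q hq] at h1
        exact h1.asymm hq
      · rintro rfl
        exact lt_irrefl _ h2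
      · rintro rfl
        exact h1.ne' hj
    rw [he, hcard]

theorem excess_detach_cases : excess (detach σ m) ≤ excess σ ∧
    (excess σ = excess (detach σ m) ↔ ¬ IsJumpedOver σ m j) := by
  have h1 := excess_detach hfix hm hj
  obtain ⟨h2, h3⟩ := card_add_le_source hfix hm hj
  obtain ⟨h4, h5⟩ := card_add_le_target hfix hm hj
  rw [IsJumpedOver, not_or, not_and, not_and, ← h3, ← h5, Fin.le_def, Fin.le_def]
  clear h3 h5
  omega

end Detach

/-! ### Induction down to the identity, and the criterion for shallowness. -/

theorem not_crossing_one {n : ℕ} :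
    ¬ (AscentCrossing (1 : Perm (Fin n)) ∨ DescentCrossing (1 : Perm (Fin n))) := by
  rintro (⟨x, y, h1, h2, -⟩ | ⟨x, z, h1, h2, -⟩)
  · exact h1.asymm h2
  · exact h1.asymm h2

theorem numCycles_one {n : ℕ} : numCycles (1 : Perm (Fin n)) = n := by
  have : ∀ x : Fin n, cycleMax 1 x = x := fun x =>
    (Perm.sameCycle_one.1 (sameCycle_cycleMax 1 x)).symm
  simp [numCycles, this]

theorem excess_one {n : ℕ} : excess (1 : Perm (Fin n)) = 0 := by
  have : inversions (1 : Perm (Fin n)) = ∅ :=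
    Finset.eq_empty_of_forall_notMem fun p hp =>
      have h := (mem_inversions 1 p.1 p.2).1 hp
      h.1.asymm h.2
  simp [excess, depth, this, numCycles_one]

/-- Nonnegativity is needed in the induction: a sum of two nonnegative terms vanishes only if both
do. The swaps used for detaching also give a factorization that attains the reflection length. -/
theorem excess_main {n : ℕ} (σ : Perm (Fin n)) : 0 ≤ excess σ ∧
    (excess σ = 0 ↔ ¬ (AscentCrossing σ ∨ DescentCrossing σ)) ∧
    ∃ l : List (Perm (Fin n)), (∀ t ∈ l, t ∈ reflections n) ∧ l.prod = σ ∧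
      l.length + numCycles σ ≤ n := by
  suffices key : ∀ d m : ℕ, m + d = n → ∀ σ : Perm (Fin n), (∀ x : Fin n, (x : ℕ) < m → σ x = x) →
      0 ≤ excess σ ∧ (excess σ = 0 ↔ ¬ (AscentCrossing σ ∨ DescentCrossing σ)) ∧
      ∃ l : List (Perm (Fin n)), (∀ t ∈ l, t ∈ reflections n) ∧ l.prod = σ ∧
        l.length + numCycles σ ≤ n from key n 0 (zero_add n) σ (by simp)
  intro d
  induction d with
  | zero =>
    intro m hmn σ hσ
    obtain rfl : σ = 1 := Equiv.ext fun x => hσ x (by omega)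
    exact ⟨excess_one.ge, by simp only [excess_one, not_crossing_one, not_false_iff],
      [], by simp, by simp, by simp [numCycles_one]⟩
  | succ d ih =>
    intro m hmn σ hσ
    let M : Fin n := ⟨m, by omega⟩
    have hfix : ∀ x < M, σ x = x := fun x hx => hσ x hx
    have hext : ∀ τ : Perm (Fin n), (∀ x < M, τ x = x) → τ M = M →
        ∀ x : Fin n, (x : ℕ) < m + 1 → τ x = x := by
      intro τ hτ hτM x hx
      rcases lt_or_ge x M with h | h
      · exact hτ x h
      · rw [le_antisymm (Fin.le_def.2 (Nat.lt_succ_iff.1 hx)) h, hτM]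
    by_cases hM : σ M = M
    · exact ih (m + 1) (by omega) σ (hext σ hfix hM)
    obtain ⟨j, hj⟩ := σ.surjective M
    have hMj := lt_of_apply_eq hfix hM hj
    obtain ⟨h1, h2, l, hl, hp, hlen⟩ := ih (m + 1) (by omega) (detach σ M)
      (hext _ (fun x hx => by
        rw [detach_apply_of_ne hx.ne (by rw [hfix x hx]; exact hx.ne), hfix x hx])
        (detach_apply_self σ M))
    obtain ⟨h3, h4⟩ := excess_detach_cases hfix hM hj
    refine ⟨h1.trans h3, ?_, swap M (σ M) :: l, ?_, ?_, ?_⟩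
    · rw [crossing_iff_detach hfix hM hj, not_or, ← h2, ← h4]
      omega
    · intro t ht
      rcases List.mem_cons.1 ht with rfl | ht
      · exact (mem_reflections_iff _).2 ⟨_, _, Ne.symm hM, rfl⟩
      · exact hl t ht
    · rw [List.prod_cons, hp, swap_mul_detach]
    · rw [numCycles_detach hfix hM] at hlen
      rw [List.length_cons]
      omega

theorem lengthT_add_numCycles {n : ℕ} (σ : Perm (Fin n)) : lengthT σ + numCycles σ = n := by
  obtain ⟨-, -, l, hl, hp, hlen⟩ := excess_main σ
  have h : lengthT σ = n - numCycles σ := by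
    refine wordLength_eq ⟨l, hl, hp, by omega⟩ fun l hl hp => ?_
    have := le_numCycles_add_length l hl
    rw [hp] at this
    omega
  omega

theorem isShallow_iff {n : ℕ} (σ : Perm (Fin n)) :
    IsShallow σ ↔ ¬ AscentCrossing σ ∧ ¬ DescentCrossing σ := by
  have h := lengthT_add_numCycles σ
  rw [← not_or, ← (excess_main σ).2.1, IsShallow, eq_div_iff two_ne_zero, excess, ← lengthS_eq]
  rw [show (n : ℤ) - numCycles σ = lengthT σ by omega, sub_sub, sub_eq_zero, mul_comm]
  norm_cast

/-! ### Occurrences of the patterns -/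

/-- Occurrences are indexed by letters rather than positions, since crossings are conditions on
letters. -/
theorem exists_isOccurrence_iff {k n : ℕ} (π : VincularPattern k) (σ : Perm (Fin n)) :
    (∃ p, π.IsOccurrence (fundamental σ) p) ↔ ∃ v : Fin k → Fin n,
      (StrictMono fun i => pos σ (v i)) ∧ (∀ i j, v i ≤ v j ↔ π.perm i ≤ π.perm j) ∧
      ∀ i j : Fin k, i ∈ π.bonds → (j : ℕ) = i + 1 → pos σ (v j) = pos σ (v i) + 1 := by
  constructor
  · rintro ⟨p, h1, h2⟩
    refine ⟨fun i => fundamental σ (p i), fun i j hij => ?_, h1, fun i j hi hij => ?_⟩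
    · simp only [pos_fundamental]
      exact p.strictMono hij
    · simpa only [pos_fundamental] using h2 i j hi hij
  · rintro ⟨v, h1, h2, h3⟩
    refine ⟨OrderEmbedding.ofStrictMono (fun i => (fundamental σ).symm (v i))
      fun i j hij => h1 hij, fun i j => ?_, h3⟩
    change fundamental σ ((fundamental σ).symm (v i)) ≤ fundamental σ ((fundamental σ).symm (v j)) ↔ _
    rw [apply_symm_apply, apply_symm_apply, h2]

theorem exists_letters_of_isOccurrence_five {n : ℕ} {σ : Perm (Fin n)} {w : Fin 5 → Fin 5}
    {hw : Function.Injective w}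
    (h : ¬ Avoids (fundamental σ) ⟨ofOneLine w hw, {1, 3}⟩) :
    ∃ v : Fin 5 → Fin n, pos σ (v 0) < pos σ (v 1) ∧ pos σ (v 2) = pos σ (v 1) + 1 ∧
      pos σ (v 2) < pos σ (v 3) ∧ pos σ (v 4) = pos σ (v 3) + 1 ∧
      ∀ i j, v i ≤ v j ↔ w i ≤ w j := by
  obtain ⟨v, h1, h2, h3⟩ := (exists_isOccurrence_iff _ σ).1 (not_not.1 h)
  exact ⟨v, h1 (by decide), h3 1 2 (by simp) rfl, h1 (by decide), h3 3 4 (by simp) rfl, h2⟩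

theorem not_avoids_five {n : ℕ} {σ : Perm (Fin n)} {w : Fin 5 → Fin 5}
    {hw : Function.Injective w} {v : Fin 5 → Fin n}
    (h0 : pos σ (v 0) < pos σ (v 1)) (h1 : pos σ (v 2) = pos σ (v 1) + 1)
    (h2 : pos σ (v 2) < pos σ (v 3)) (h3 : pos σ (v 4) = pos σ (v 3) + 1)
    (h : ∀ i j, v i ≤ v j ↔ w i ≤ w j) :
    ¬ Avoids (fundamental σ) ⟨ofOneLine w hw, {1, 3}⟩ := by
  refine not_not.2 ((exists_isOccurrence_iff _ σ).2 ⟨v, ?_, h, ?_⟩)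
  · rw [Fin.strictMono_iff_lt_succ]
    intro i
    fin_cases i
    · exact h0
    · exact h1 ▸ Nat.lt_succ_self _
    · exact h2
    · exact h3 ▸ Nat.lt_succ_self _
  · intro i j hi hij
    simp only [Finset.mem_insert, Finset.mem_singleton] at hi
    rcases hi with rfl | rfl
    · obtain rfl : j = 2 := Fin.ext hij
      exact h1
    · obtain rfl : j = 4 := Fin.ext hij
      exact h3

/-- Both patterns of size 5 satisfy these inequalities. The early letter `c > b` keeps `b` from
starting a cycle, so `σ x = b`; if `a` starts a cycle, then `σ y` is a cycle maximum that is at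
least `c`. -/
theorem ascentCrossing_of_letters {n : ℕ} {σ : Perm (Fin n)} {c y a x b : Fin n}
    (hcy : pos σ c < pos σ y) (hya : pos σ a = pos σ y + 1) (hax : pos σ a < pos σ x)
    (hxb : pos σ b = pos σ x + 1) (h1 : x < y) (h2 : y < b) (h3 : b < a) (h4 : b < c) :
    AscentCrossing σ := by
  have hb : σ x = b := by
    rcases pos_eq_add_one hxb with h | ⟨h, -⟩
    · exact h
    · have := cycleMax_le_of_pos_lt (σ := σ) (x := c) (y := b) (by omega)
      exact absurd (h4.trans_le ((le_cycleMax σ c).trans this)) (by rw [h]; exact lt_irrefl _)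
  refine ⟨x, y, h1, hb ▸ h2, ?_, by omega⟩
  rw [hb]
  rcases pos_eq_add_one hya with h | ⟨-, h, -⟩
  · exact h ▸ h3
  · rw [h]
    exact h4.trans_le ((le_cycleMax σ c).trans (cycleMax_le_of_pos_lt hcy))

theorem not_ascentCrossing_iff {n : ℕ} (σ : Perm (Fin n)) : ¬ AscentCrossing σ ↔
    Avoids (fundamental σ) pattern_5_24_13 ∧ Avoids (fundamental σ) pattern_4_25_13 := by
  rw [← not_iff_not, not_not, not_and_or]
  constructor
  · rintro ⟨x, y, h1, h2, h3, hp⟩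
    have hle := cycleMax_le_of_pos_lt hp
    have hpy := pos_cycleMax_le σ y
    have hyy := apply_le_cycleMax σ y
    have hx : cycleMax σ (σ x) ≠ σ x := fun e => by
      rw [cycleMax_apply] at e
      exact (h3.trans_le (hyy.trans hle)).ne' e
    have hpx := pos_apply hx
    have hc : pos σ (cycleMax σ y) < pos σ y := lt_of_le_of_ne hpy fun e =>
      ((h2.trans h3).trans_le hyy).ne' (pos_injective σ e)
    -- If `y` ends its cycle, `σ y` precedes `y` as the letter `4`, and the start of the next cycle
    -- is the `5`. Otherwise `σ y` follows `y` as the `4`, with the cycle maximum as the `5`.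
    by_cases hy : cycleMax σ (σ y) = σ y
    · right
      rw [cycleMax_apply] at hy
      have hpx' : pos σ x < n := Fin.is_lt _
      obtain ⟨a, ha⟩ : ∃ a, pos σ a = pos σ y + 1 :=
        ⟨fundamental σ ⟨pos σ y + 1, by omega⟩, pos_fundamental σ _⟩
      have hya : σ y < a := by
        rcases pos_eq_add_one ha with e | ⟨-, e, hlt⟩
        · have := pos_apply (σ := σ) (x := y)
          rw [← e, ← hy] at ha
          omega
        · exact e ▸ hlt
      refine not_avoids_five (v := ![σ y, y, a, x, σ x]) (hy ▸ hc) ha ?_ hpx ?_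
      · show pos σ a < pos σ x
        refine lt_of_le_of_ne (by omega) fun e => ?_
        rw [pos_injective σ e] at hya
        exact hya.asymm ((h1.trans h2).trans h3)
      · intro i j
        fin_cases i <;> fin_cases j <;> simp <;> omega
    · left
      have hpy' := pos_apply hy
      have hlt : σ y < cycleMax σ y :=
        lt_of_le_of_ne hyy fun e => hy ((cycleMax_apply σ y).trans e.symm)
      refine not_avoids_five (v := ![cycleMax σ y, y, σ y, x, σ x]) hc hpy' ?_ hpx ?_
      · show pos σ (σ y) < pos σ x
        refine lt_of_le_of_ne (by omega) fun e => ?_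
        exact ((h1.trans h2).trans h3).ne' (pos_injective σ e)
      · intro i j
        fin_cases i <;> fin_cases j <;> simp <;> omega
  · rintro (h | h)
    · obtain ⟨v, h1, h2, h3, h4, h⟩ := exists_letters_of_isOccurrence_five h
      refine ascentCrossing_of_letters h1 h2 h3 h4 ?_ ?_ ?_ ?_ <;>
        simp only [← not_le, h] <;> decide
    · obtain ⟨v, h1, h2, h3, h4, h⟩ := exists_letters_of_isOccurrence_five h
      refine ascentCrossing_of_letters h1 h2 h3 h4 ?_ ?_ ?_ ?_ <;>
        simp only [← not_le, h] <;> decide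

theorem not_descentCrossing_iff {n : ℕ} (σ : Perm (Fin n)) : ¬ DescentCrossing σ ↔
    Avoids (fundamental σ) pattern_31_42 := by
  -- A new cycle always begins with a rise in the word, so descents of the word are exactly the
  -- descending arcs.
  have hrec : ∀ x y, y < x → pos σ y = pos σ x + 1 → σ x = y := by
    intro x y hxy h
    rcases pos_eq_add_one h with h | ⟨-, -, h⟩
    · exact h
    · exact absurd (h.trans hxy) (le_cycleMax σ x).not_gt
  have happ : ∀ x, σ x < x → pos σ (σ x) = pos σ x + 1 := fun x hx => pos_apply fun e => by
    rw [cycleMax_apply] at e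
    exact (le_cycleMax σ x).not_gt (e ▸ hx)
  rw [← not_iff_not, not_not, Avoids, not_not, exists_isOccurrence_iff]
  constructor
  · rintro ⟨x, z, h1, h2, h3, hp⟩
    have hx := happ x (h1.trans h2)
    have hz := happ z (h2.trans h3)
    refine ⟨![x, σ x, z, σ z], ?_, ?_, ?_⟩
    · rw [Fin.strictMono_iff_lt_succ]
      intro i
      fin_cases i
      · exact hx ▸ Nat.lt_succ_self _
      · exact lt_of_le_of_ne (Nat.le_of_lt_succ (by show pos σ (σ x) < pos σ z + 1; omega))
          fun e => ((h1.trans h2).trans h3).ne (pos_injective σ e)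
      · exact hz ▸ Nat.lt_succ_self _
    · intro i j
      fin_cases i <;> fin_cases j <;> simp [pattern_31_42, ofOneLine] <;> omega
    · intro i j hi hij
      simp only [pattern_31_42, Finset.mem_insert, Finset.mem_singleton] at hi
      rcases hi with rfl | rfl
      · obtain rfl : j = 1 := Fin.ext hij
        exact hx
      · obtain rfl : j = 3 := Fin.ext hij
        exact hz
  · rintro ⟨v, h1, h2, h3⟩
    have hlt : ∀ i j, ¬ pattern_31_42.perm j ≤ pattern_31_42.perm i → v i < v j := fun i j h =>
      not_le.1 fun h' => h ((h2 j i).1 h')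
    have e1 : σ (v 0) = v 1 :=
      hrec _ _ (hlt _ _ (by simp [pattern_31_42, ofOneLine])) (h3 0 1 (by simp [pattern_31_42]) rfl)
    have e2 : σ (v 2) = v 3 :=
      hrec _ _ (hlt _ _ (by simp [pattern_31_42, ofOneLine])) (h3 2 3 (by simp [pattern_31_42]) rfl)
    refine ⟨v 0, v 2, ?_, ?_, ?_, h1 (by decide)⟩
    · rw [e1, e2]
      exact hlt _ _ (by simp [pattern_31_42, ofOneLine])
    · rw [e2]
      exact hlt _ _ (by simp [pattern_31_42, ofOneLine])
    · exact hlt _ _ (by simp [pattern_31_42, ofOneLine])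

end ShallowPerm

theorem mainTheorem1 (n : ℕ) (σ : Equiv.Perm (Fin n)) :
    ShallowPerm.IsShallow σ ↔
      (ShallowPerm.Avoids (ShallowPerm.fundamental σ) ShallowPerm.pattern_5_24_13 ∧
        ShallowPerm.Avoids (ShallowPerm.fundamental σ) ShallowPerm.pattern_4_25_13 ∧
        ShallowPerm.Avoids (ShallowPerm.fundamental σ) ShallowPerm.pattern_31_42) := by
  rw [ShallowPerm.isShallow_iff, ShallowPerm.not_ascentCrossing_iff,
    ShallowPerm.not_descentCrossing_iff, and_assoc]
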